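/- Let $n\ge 2$, let $\mathbb B^n$ be the open unit ball of $\mathbb R^n$, and let $f\colon\mathbb B^n\to\mathbb R^n$ be a bounded quasiregular mapping; that is, $f$ is bounded, its coordinate functions belong to $W^{1,n}_{\mathrm{loc}}(\mathbb B^n)$, and there is a constant $K<\infty$ such that $|Df(x)|^n\le K\,J_f(x)$ for a.e. $x\in\mathbb B^n$, where $Df$ is the weak derivative of $f$, $|Df(x)|$ is its operator norm and $J_f=\det Df$. For $A\subset\mathbb B^n$ let $$N(f,A)=\sup_{y\in\mathbb R^n}\operatorname{card}\{x\in A: f(x)=y\}.$$ Let $1<q<n$ and let $$w(x)=\sum_{j=0}^\infty c_j\,\bigl|1-|x|\bigr|^{q-1}\,\chi_{R_j}(x),\qquad R_j=\{x\in\mathbb R^n: 1-2^{-j}<|x|\le 1-2^{-j-1}\},\quad j=0,1,2,\dots,$$ where $\chi_{R_j}$ is the characteristic function of $R_j$ and the $c_j$ are positive constants such that, for some $b>0$, $$\sum_{j=1}^\infty \frac{c_j}{j^{\,bq/n}}<\infty .$$ Assume that for the same $b$ there is a constant $C$ such that $$N(f,B(0,r))\le C\,(1-r)^{-(n-1)}\left(\frac{1}{\log\frac{1}{1-r}}\right)^{b}\qquad\text{for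 all }0<r<1,$$ where $B(0,r)$ is the open ball of radius $r$ centered at the origin. Then $$\int_{\mathbb B^n}|Df(x)|^q\,w(x)\,dx<\infty .$$ -/

import Mathlib

open MeasureTheory Set
open scoped ENNReal ContDiff

namespace QRMap

/-- `n`-dimensional Euclidean space. -/
abbrev E (n : ℕ) : Type := EuclideanSpace ℝ (Fin n)

/-- `Df` is a weak (distributional) derivative of `f` in the open set `Ω`: both are locally
integrable in `Ω` and `∫ (∂_v φ) f = - ∫ φ (Df v)` for all directions `v` and all
real test functions `φ ∈ C_c^∞(Ω)`. -/
structure HasWeakDerivOn {n : ℕ} (Ω : Set (E n)) (f : E n → E n)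
    (Df : E n → E n →L[ℝ] E n) : Prop where
  locallyIntegrable : LocallyIntegrableOn f Ω volume
  locallyIntegrable_deriv : LocallyIntegrableOn Df Ω volume
  integral_eq : ∀ φ : E n → ℝ, ContDiff ℝ ∞ φ → HasCompactSupport φ → tsupport φ ⊆ Ω →
    ∀ v : E n, ∫ x in Ω, (fderiv ℝ φ x v) • f x = - ∫ x in Ω, φ x • Df x v

/-- Membership in `L^p_loc(Ω)`. -/
def LocMemLpOn {n : ℕ} {F : Type*} [NormedAddCommGroup F] (p : ℝ≥0∞) (Ω : Set (E n))
    (g : E n → F) : Prop :=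
  ∀ K : Set (E n), IsCompact K → K ⊆ Ω → MemLp g p (volume.restrict K)

/-- `f` is quasiregular in `Ω`: `f ∈ W^{1,n}_loc(Ω; ℝⁿ)` and its dilatation `|Df|ⁿ / J_f` is
essentially bounded, that is, `|Df|ⁿ ≤ K J_f` a.e. in `Ω` for some finite constant `K`. Here `|Df|`
is the operator norm and `J_f = det Df`. -/
def IsQuasiregularOn {n : ℕ} (Ω : Set (E n)) (f : E n → E n) : Prop :=
  ∃ Df : E n → E n →L[ℝ] E n,
    HasWeakDerivOn Ω f Df ∧ LocMemLpOn n Ω f ∧ LocMemLpOn n Ω Df ∧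
      ∃ K : ℝ, ∀ᵐ x ∂(volume.restrict Ω), ‖Df x‖ ^ n ≤ K * (Df x).det

/-- `n(y; f, A) = card {x ∈ A : f x = y}`. -/
noncomputable def countPreimages {n : ℕ} (y : E n) (f : E n → E n) (A : Set (E n)) : ℕ∞ :=
  {x | x ∈ A ∧ f x = y}.encard

/-- The multiplicity function `N(f, A) = sup_y n(y; f, A)`. -/
noncomputable def multiplicity {n : ℕ} (f : E n → E n) (A : Set (E n)) : ℕ∞ :=
  ⨆ y : E n, countPreimages y f A

/-- The ring `R_j = {x : 1 - 2^{-j} < |x| ≤ 1 - 2^{-j-1}}`. -/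
def dyadicRing (n j : ℕ) : Set (E n) :=
  {x | 1 - (2 : ℝ)⁻¹ ^ j < ‖x‖ ∧ ‖x‖ ≤ 1 - (2 : ℝ)⁻¹ ^ (j + 1)}

/-- The weight `w(x) = ∑_{j ≥ 0} c_j |1 - |x||^{q-1} χ_{R_j}(x)`. The rings are disjoint, so at most
one term of the sum is nonzero at each `x`. -/
noncomputable def weight (n : ℕ) (q : ℝ) (c : ℕ → ℝ) (x : E n) : ℝ :=
  ∑' j : ℕ, c j * |1 - ‖x‖| ^ (q - 1) * (dyadicRing n j).indicator (fun _ => (1 : ℝ)) x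

end QRMap

/-! On the ring `R_j` the weight is at most `c_j 2^{-j(q-1)}`, and Hölder gives `∫_{R_j} |Df|^q ≤
(∫_{R_j} |Df|^n)^{q/n} |R_j|^{1-q/n}` with `|R_j| ≲ 2^{-j}`. Quasiregularity bounds `|Df|^n` by the
Jacobian, whose integral over `B(0,r)` is at most `N(f, B(0,r))` times the volume of a ball
containing the image. The multiplicity hypothesis at `1 - r = 2^{-(j+2)}` makes this `≲ 2^{j(n-1)}
(j+1)^{-b}`. All powers of `2^j` cancel, leaving `c_j (j+1)^{-bq/n}`, which is summable.

The substantial point is the area inequality `∫ |J_f| ≤ N · |image|` for a map that is only weakly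
differentiable. Only this inequality is needed, so null sets may be discarded and Lusin's condition
(N) plays no role. It suffices to exhaust almost all of the domain by measurable sets on each of
which `f` is differentiable relative to the set, with the weak derivative as derivative
(`IsWeakDeriv.exists_exhaustion_hasFDerivWithinAt`). Mollifications whose gradients converge fast in
`L¹` supply them: by the weak type bound for the maximal function and Borel–Cantelli, almost every
point eventually avoids the sets where consecutive differences fail to have Lipschitz constant `≲
2^{-k}`. On each such set, `lintegral_abs_det_le_mul_measure` cuts the noncritical points into
countably many pieces of injectivity and counts preimages. A cutoff reduces the ball to the whole
space. -/

theorem enorm_sub_le_lintegral_enorm_fderiv {V F : Type*} [NormedAddCommGroup V] [NormedSpace ℝ V]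
    [NormedAddCommGroup F] [NormedSpace ℝ F] [CompleteSpace F] {u : V → F} (hu : ContDiff ℝ 1 u)
    (x z : V) :
    ‖u z - u x‖ₑ ≤ ∫⁻ t in Ioc (0 : ℝ) 1, ‖fderiv ℝ u (x + t • (z - x))‖ₑ * ‖z - x‖ₑ := by
  have hd : ∀ t : ℝ, HasDerivAt (fun t : ℝ => u (x + t • (z - x)))
      (fderiv ℝ u (x + t • (z - x)) (z - x)) t := by
    intro t
    have h1 : HasDerivAt (fun t : ℝ => x + t • (z - x)) (z - x) t := by
      simpa using ((hasDerivAt_id t).smul_const (z - x)).const_add x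
    exact ((hu.differentiable (by norm_num)) _).hasFDerivAt.comp_hasDerivAt t h1
  have hc : Continuous fun t : ℝ => fderiv ℝ u (x + t • (z - x)) (z - x) :=
    ((hu.continuous_fderiv (by norm_num)).comp (by fun_prop)).clm_apply continuous_const
  have h := intervalIntegral.integral_eq_sub_of_hasDerivAt (a := 0) (b := 1)
    (fun t _ => hd t) (hc.intervalIntegrable _ _)
  simp only [one_smul, zero_smul, add_zero, add_sub_cancel] at h
  rw [← h, intervalIntegral.integral_of_le zero_le_one]
  refine (enorm_integral_le_lintegral_enorm _).trans (lintegral_mono fun t => ?_)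
  exact ContinuousLinearMap.le_opENorm _ _

/-! ### Local maximal function and pointwise Lipschitz estimates -/

section Maximal

open Metric Module

variable {V : Type*} [NormedAddCommGroup V] [NormedSpace ℝ V] [FiniteDimensional ℝ V]
  [MeasurableSpace V] [BorelSpace V] (μ : Measure V) [μ.IsAddHaarMeasure]

/-- The set where the local maximal function (radii at most `1`) of `g` exceeds `lam`. -/
def maximalSuperlevel (g : V → ℝ≥0∞) (lam : ℝ≥0∞) : Set V :=
  {x | ∃ r : ℝ, 0 < r ∧ r ≤ 1 ∧ lam * μ (closedBall x r) < ∫⁻ y in closedBall x r, g y ∂μ}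

/-- Weak type `(1, 1)` estimate for the local maximal function. -/
theorem mul_measure_maximalSuperlevel_le (g : V → ℝ≥0∞) (lam : ℝ≥0∞) :
    lam * μ (maximalSuperlevel μ g lam) ≤ ENNReal.ofReal (4 ^ finrank ℝ V) * ∫⁻ y, g y ∂μ := by
  classical
  have hex : ∀ x : V, ∃ r : ℝ, x ∈ maximalSuperlevel μ g lam →
      0 < r ∧ r ≤ 1 ∧ lam * μ (closedBall x r) < ∫⁻ y in closedBall x r, g y ∂μ := by
    intro x
    by_cases hx : x ∈ maximalSuperlevel μ g lam
    · obtain ⟨r, hr⟩ := hx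
      exact ⟨r, fun _ => hr⟩
    · exact ⟨0, fun h => absurd h hx⟩
  choose r hr using hex
  -- Bounding the radii by `1` is what makes Vitali's covering argument available. Its enlargement
  -- factor `4` produces the constant `4 ^ finrank ℝ V`.
  obtain ⟨u, hut, hdisj, hcov⟩ := Vitali.exists_disjoint_subfamily_covering_enlargement_closedBall
    (maximalSuperlevel μ g lam) id r 1 (fun a ha => (hr a ha).2.1) 4 (by norm_num)
  have hucount : u.Countable := by
    refine hdisj.countable_of_nonempty_interior fun a ha => ?_
    exact ⟨a, ball_subset_interior_closedBall (mem_ball_self (hr a (hut ha)).1)⟩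
  have := hucount.to_subtype
  have hsub : maximalSuperlevel μ g lam ⊆ ⋃ b ∈ u, closedBall b (4 * r b) := by
    intro a ha
    obtain ⟨b, hb, hab⟩ := hcov a ha
    exact mem_biUnion hb (hab (mem_closedBall_self (hr a ha).1.le))
  calc lam * μ (maximalSuperlevel μ g lam)
      ≤ lam * ∑' b : u, μ (closedBall (b : V) (4 * r b)) := by
        gcongr
        exact (measure_mono hsub).trans (measure_biUnion_le μ hucount _)
    _ = ∑' b : u, ENNReal.ofReal (4 ^ finrank ℝ V) * (lam * μ (closedBall (b : V) (r b))) := by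
        rw [← ENNReal.tsum_mul_left]
        congr 1 with b
        rw [Measure.addHaar_closedBall_mul μ (b : V) (by norm_num) (hr b (hut b.2)).1.le,
          Measure.addHaar_closedBall_center μ (b : V)]
        ring
    _ ≤ ∑' b : u, ENNReal.ofReal (4 ^ finrank ℝ V) * ∫⁻ y in closedBall (b : V) (r b), g y ∂μ := by
        gcongr with b
        exact (hr b (hut b.2)).2.2.le
    _ = ENNReal.ofReal (4 ^ finrank ℝ V) * ∫⁻ y in ⋃ b ∈ u, closedBall b (r b), g y ∂μ := by
        rw [ENNReal.tsum_mul_left]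
        congr 1
        exact (lintegral_biUnion hucount (fun b _ => measurableSet_closedBall) hdisj g).symm
    _ ≤ _ := by
        gcongr
        exact Measure.restrict_le_self

/-- Change of variables for the homothety centred at `x` with ratio `t`: translation invariance
reduces it to the scaling of Haar measure. -/
theorem setLIntegral_closedBall_comp_homothety (x : V) {r t : ℝ} (ht : 0 < t)
    {g : V → ℝ≥0∞} (hg : Measurable g) :
    ENNReal.ofReal (t ^ finrank ℝ V) * ∫⁻ z in closedBall x r, g (x + t • (z - x)) ∂μ
      = ∫⁻ z in closedBall x (t * r), g z ∂μ := by
  have h0 : ∀ z, (closedBall x r).indicator (fun z => g (x + t • (z - x))) z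
      = (closedBall x (t * r)).indicator g (x + t • (z - x)) := by
    intro z
    have : z ∈ closedBall x r ↔ x + t • (z - x) ∈ closedBall x (t * r) := by
      simp [mem_closedBall, dist_eq_norm, norm_smul, abs_of_pos ht, ht]
    by_cases hz : z ∈ closedBall x r
    · rw [indicator_of_mem hz, indicator_of_mem (this.1 hz)]
    · rw [indicator_of_notMem hz, indicator_of_notMem (fun h => hz (this.2 h))]
  have hm : Measurable ((closedBall x (t * r)).indicator g) := hg.indicator measurableSet_closedBall
  rw [← lintegral_indicator measurableSet_closedBall, ← lintegral_indicator measurableSet_closedBall]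
  simp_rw [h0]
  rw [lintegral_sub_right_eq_self (fun z => (closedBall x (t * r)).indicator g (x + t • z)) x,
    ← lintegral_map (f := fun z => (closedBall x (t * r)).indicator g (x + z))
      (hm.comp (measurable_const_add x)) (measurable_const_smul t),
    Measure.map_addHaar_smul μ ht.ne', lintegral_smul_measure, lintegral_add_left_eq_self,
    smul_eq_mul, ← mul_assoc, ← ENNReal.ofReal_mul (by positivity),
    abs_of_pos (by positivity), mul_inv_cancel₀ (by positivity), ENNReal.ofReal_one, one_mul]

variable {F : Type*} [NormedAddCommGroup F] [NormedSpace ℝ F] [CompleteSpace F]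

/-- The mean oscillation of a `C¹` map around a point is controlled by the averages of its
derivative around that point. -/
theorem lintegral_enorm_sub_le_of_average_fderiv_le {u : V → F} (hu : ContDiff ℝ 1 u) {x : V}
    {lam : ℝ≥0∞} {r : ℝ} (hr1 : r ≤ 1)
    (hx : x ∉ maximalSuperlevel μ (fun z => ‖fderiv ℝ u z‖ₑ) lam) (hr : 0 < r) :
    ∫⁻ z in closedBall x r, ‖u z - u x‖ₑ ∂μ ≤ ENNReal.ofReal r * lam * μ (closedBall x r) := by
  have hg : Continuous fun z => ‖fderiv ℝ u z‖ₑ := (hu.continuous_fderiv (by norm_num)).enorm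
  have hinner : ∀ t ∈ Ioc (0 : ℝ) 1,
      ∫⁻ z in closedBall x r, ‖fderiv ℝ u (x + t • (z - x))‖ₑ ∂μ ≤ lam * μ (closedBall x r) := by
    intro t ht
    -- The shrunken ball still has radius at most `1`, so its average is bounded by `lam`; the
    -- factor `t ^ finrank ℝ V` then appears on both sides and cancels.
    have hx' : ∫⁻ y in closedBall x (t * r), ‖fderiv ℝ u y‖ₑ ∂μ
        ≤ lam * μ (closedBall x (t * r)) := by
      by_contra! h
      exact hx ⟨t * r, mul_pos ht.1 hr, (mul_le_one₀ ht.2 hr.le hr1), h⟩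
    rw [← setLIntegral_closedBall_comp_homothety μ x ht.1 hg.measurable,
      Measure.addHaar_closedBall_mul μ x ht.1.le hr.le,
      ← Measure.addHaar_closedBall_center μ x, mul_left_comm] at hx'
    rwa [ENNReal.mul_le_mul_iff_right] at hx'
    · simpa using pow_pos ht.1 _
    · exact ENNReal.ofReal_ne_top
  calc ∫⁻ z in closedBall x r, ‖u z - u x‖ₑ ∂μ
      ≤ ∫⁻ z in closedBall x r, (∫⁻ t in Ioc (0 : ℝ) 1,
          ‖fderiv ℝ u (x + t • (z - x))‖ₑ * ENNReal.ofReal r) ∂μ := by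
        refine setLIntegral_mono' measurableSet_closedBall fun z hz => ?_
        refine (enorm_sub_le_lintegral_enorm_fderiv hu x z).trans ?_
        gcongr
        rw [← ofReal_norm]
        exact ENNReal.ofReal_le_ofReal (by simpa [dist_eq_norm] using hz)
    _ = ∫⁻ t in Ioc (0 : ℝ) 1, ∫⁻ z in closedBall x r,
          ‖fderiv ℝ u (x + t • (z - x))‖ₑ * ENNReal.ofReal r ∂μ := by
        refine lintegral_lintegral_swap (Continuous.measurable ?_).aemeasurable
        exact (ENNReal.continuous_mul_const ENNReal.ofReal_ne_top).comp (hg.comp (by fun_prop))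
    _ ≤ ∫⁻ t in Ioc (0 : ℝ) 1, ENNReal.ofReal r * lam * μ (closedBall x r) := by
        refine setLIntegral_mono' measurableSet_Ioc fun t ht => ?_
        rw [lintegral_mul_const' _ _ ENNReal.ofReal_ne_top, mul_comm, mul_assoc]
        gcongr
        exact hinner t ht
    _ = _ := by simp

/-- A `C¹` map is Lipschitz, at scales at most `1`, on the set where the local maximal function of
its derivative is bounded. -/
theorem enorm_sub_le_of_notMem_maximalSuperlevel {u : V → F} (hu : ContDiff ℝ 1 u) {x y : V}
    {lam : ℝ≥0∞} (hxy : dist x y ≤ 1)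
    (hx : x ∉ maximalSuperlevel μ (fun z => ‖fderiv ℝ u z‖ₑ) lam)
    (hy : y ∉ maximalSuperlevel μ (fun z => ‖fderiv ℝ u z‖ₑ) lam) :
    ‖u x - u y‖ₑ ≤ 2 ^ (finrank ℝ V + 1) * lam * ENNReal.ofReal (dist x y) := by
  rcases eq_or_ne x y with rfl | hne
  · simp
  set r := dist x y with hrdef
  have hr : 0 < r := dist_pos.2 hne
  -- The ball of radius `r / 2` about the midpoint lies in both balls of radius `r` about `x` and
  -- `y`. Averaging the triangle inequality through `u z` over it costs the volume ratio `2 ^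
  -- finrank ℝ V`.
  set m := midpoint ℝ x y
  have hmx : closedBall m (2⁻¹ * r) ⊆ closedBall x r := by
    refine closedBall_subset_closedBall' ?_
    have : dist m x = 2⁻¹ * r := by simp [m, hrdef]
    linarith
  have hmy : closedBall m (2⁻¹ * r) ⊆ closedBall y r := by
    refine closedBall_subset_closedBall' ?_
    have : dist m y = 2⁻¹ * r := by simp [m, hrdef]
    linarith
  have hcont : Continuous u := hu.continuous
  set B := μ (closedBall (0 : V) r)
  have hB0 : B ≠ 0 := (measure_closedBall_pos μ _ hr).ne'
  have hBt : B ≠ ⊤ := measure_closedBall_lt_top.ne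
  have key : ‖u x - u y‖ₑ * (ENNReal.ofReal (2⁻¹ ^ finrank ℝ V) * B)
      ≤ 2 * (ENNReal.ofReal r * lam * B) := by
    calc ‖u x - u y‖ₑ * (ENNReal.ofReal (2⁻¹ ^ finrank ℝ V) * B)
        = ∫⁻ z in closedBall m (2⁻¹ * r), ‖u x - u y‖ₑ ∂μ := by
          rw [lintegral_const, Measure.restrict_apply_univ,
            Measure.addHaar_closedBall_mul μ m (by norm_num) hr.le]
      _ ≤ ∫⁻ z in closedBall m (2⁻¹ * r), (‖u z - u x‖ₑ + ‖u z - u y‖ₑ) ∂μ := by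
          refine lintegral_mono fun z => ?_
          have : u x - u y = (u z - u y) - (u z - u x) := by abel
          rw [this, add_comm]
          exact enorm_sub_le
      _ = ∫⁻ z in closedBall m (2⁻¹ * r), ‖u z - u x‖ₑ ∂μ
          + ∫⁻ z in closedBall m (2⁻¹ * r), ‖u z - u y‖ₑ ∂μ :=
          lintegral_add_left (hcont.sub continuous_const).enorm.measurable _
      _ ≤ ∫⁻ z in closedBall x r, ‖u z - u x‖ₑ ∂μ + ∫⁻ z in closedBall y r, ‖u z - u y‖ₑ ∂μ :=
          add_le_add (lintegral_mono_set hmx) (lintegral_mono_set hmy)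
      _ ≤ ENNReal.ofReal r * lam * B + ENNReal.ofReal r * lam * B := by
          refine add_le_add ?_ ?_
          · exact (lintegral_enorm_sub_le_of_average_fderiv_le μ hu hxy hx hr).trans_eq
              (by rw [Measure.addHaar_closedBall_center])
          · exact (lintegral_enorm_sub_le_of_average_fderiv_le μ hu hxy hy hr).trans_eq
              (by rw [Measure.addHaar_closedBall_center])
      _ = _ := by ring
  rw [← mul_assoc, ← mul_assoc 2 _ B, ENNReal.mul_le_mul_iff_left hB0 hBt] at key
  have h2 : (2 : ℝ≥0∞) ^ finrank ℝ V * ENNReal.ofReal (2⁻¹ ^ finrank ℝ V) = 1 := by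
    rw [ENNReal.ofReal_pow (by norm_num), ENNReal.ofReal_inv_of_pos (by norm_num), ← mul_pow]
    simp [ENNReal.mul_inv_cancel]
  calc ‖u x - u y‖ₑ
      = 2 ^ finrank ℝ V * (‖u x - u y‖ₑ * ENNReal.ofReal (2⁻¹ ^ finrank ℝ V)) := by
        rw [mul_left_comm, h2, mul_one]
    _ ≤ 2 ^ finrank ℝ V * (2 * (ENNReal.ofReal r * lam)) := by gcongr
    _ = _ := by ring

end Maximal

/-! ### Mollification and weak derivatives -/

section Mollification

open Metric Module Filter Topology ContinuousLinearMap
open scoped Convolution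

/-- Almost everywhere convergence without gain of `L¹` mass implies convergence in `L¹`. -/
theorem tendsto_lintegral_enorm_sub_of_ae_tendsto {α F : Type*} [MeasurableSpace α]
    [NormedAddCommGroup F] {ν : Measure α} {G : α → F} {Gk : ℕ → α → F} (hG : Integrable G ν)
    (hGk : ∀ k, AEStronglyMeasurable (Gk k) ν)
    (hle : ∀ k, ∫⁻ x, ‖Gk k x‖ₑ ∂ν ≤ ∫⁻ x, ‖G x‖ₑ ∂ν)
    (hlim : ∀ᵐ x ∂ν, Tendsto (fun k => Gk k x) atTop (𝓝 (G x))) :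
    Tendsto (fun k => ∫⁻ x, ‖Gk k x - G x‖ₑ ∂ν) atTop (𝓝 0) := by
  set I := ∫⁻ x, ‖G x‖ₑ ∂ν
  have hI : I ≠ ⊤ := hG.2.ne
  have hdm : ∀ k, AEMeasurable (fun x => ‖Gk k x - G x‖ₑ) ν := fun k => ((hGk k).sub hG.1).enorm
  -- These functions are nonnegative and tend a.e. to `2‖G‖`, so Fatou bounds their integrals below
  -- by `2I` in the limit. The total available mass is at most `2I`, so nothing is left for `‖Gk -
  -- G‖`.
  set s : ℕ → α → ℝ≥0∞ := fun k x => ‖G x‖ₑ + ‖Gk k x‖ₑ - ‖Gk k x - G x‖ₑ with hs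
  have hsm : ∀ k, AEMeasurable (s k) ν := fun k => (hG.1.enorm.add (hGk k).enorm).sub (hdm k)
  have hsum : ∀ k, ∫⁻ x, ‖Gk k x - G x‖ₑ ∂ν + ∫⁻ x, s k x ∂ν ≤ I + I := by
    intro k
    rw [← lintegral_add_left' (hdm k)]
    calc ∫⁻ x, (‖Gk k x - G x‖ₑ + s k x) ∂ν
        = ∫⁻ x, (‖G x‖ₑ + ‖Gk k x‖ₑ) ∂ν := by
          congr 1 with x
          refine add_tsub_cancel_of_le ?_
          rw [add_comm]
          exact enorm_sub_le
      _ = I + ∫⁻ x, ‖Gk k x‖ₑ ∂ν := lintegral_add_left' hG.1.enorm _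
      _ ≤ I + I := by gcongr; exact hle k
  have hfatou : I + I ≤ liminf (fun k => ∫⁻ x, s k x ∂ν) atTop := by
    refine le_trans (le_of_eq ?_) (lintegral_liminf_le' hsm)
    rw [← lintegral_add_left' hG.1.enorm]
    refine lintegral_congr_ae ?_
    filter_upwards [hlim] with x hx
    symm
    refine Tendsto.liminf_eq ?_
    have h1 : Tendsto (fun k => ‖Gk k x - G x‖ₑ) atTop (𝓝 0) := by
      simpa using (hx.sub_const (G x)).enorm
    have h2 := ENNReal.Tendsto.sub ((tendsto_const_nhds (x := ‖G x‖ₑ)).add hx.enorm) h1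
      (Or.inr ENNReal.zero_ne_top)
    simpa using h2
  rw [ENNReal.tendsto_nhds_zero]
  intro ε hε
  rcases eq_or_ne (I + I) 0 with h0 | h0
  · refine Eventually.of_forall fun k => ?_
    have := hsum k
    rw [h0] at this
    exact (le_self_add.trans this).trans zero_le
  rcases eq_or_ne ε ⊤ with rfl | hεt
  · simp
  have hlt : I + I - ε < liminf (fun k => ∫⁻ x, s k x ∂ν) atTop :=
    (ENNReal.sub_lt_self (ENNReal.add_ne_top.2 ⟨hI, hI⟩) h0 hε.ne').trans_le hfatou
  filter_upwards [eventually_lt_of_lt_liminf hlt] with k hk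
  have hk' : I + I ≤ ∫⁻ x, s k x ∂ν + ε := tsub_le_iff_right.1 hk.le
  have hst : ∫⁻ x, s k x ∂ν ≠ ⊤ :=
    ne_top_of_le_ne_top (ENNReal.add_ne_top.2 ⟨hI, hI⟩) (le_add_self.trans (hsum k))
  have h3 := (hsum k).trans hk'
  rw [add_comm (∫⁻ x, s k x ∂ν) ε] at h3
  exact (ENNReal.add_le_add_iff_right hst).1 h3

variable {V : Type*} [NormedAddCommGroup V] [NormedSpace ℝ V] [FiniteDimensional ℝ V]
  [MeasurableSpace V] [BorelSpace V] {μ : Measure V} [μ.IsAddHaarMeasure]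
  {F : Type*} [NormedAddCommGroup F] [NormedSpace ℝ F]

/-- Convolution with a normalized bump function does not increase the `L¹` norm. -/
theorem lintegral_enorm_convolution_normed_le (φ : ContDiffBump (0 : V)) {G : V → F}
    (hG : AEStronglyMeasurable G μ) :
    ∫⁻ x, ‖(φ.normed μ ⋆[lsmul ℝ ℝ, μ] G) x‖ₑ ∂μ ≤ ∫⁻ x, ‖G x‖ₑ ∂μ := by
  have hφm : AEStronglyMeasurable (φ.normed μ) μ :=
    (φ.continuous_normed (μ := μ)).aestronglyMeasurable
  have hφ : ∫⁻ t, ‖φ.normed μ t‖ₑ ∂μ = 1 := by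
    have h := φ.integral_normed (μ := μ)
    rw [integral_eq_lintegral_of_nonneg_ae (ae_of_all _ φ.nonneg_normed) hφm] at h
    rw [← ENNReal.toReal_eq_one_iff, ← h]
    congr 2 with t
    rw [Real.enorm_of_nonneg (φ.nonneg_normed t)]
  calc ∫⁻ x, ‖(φ.normed μ ⋆[lsmul ℝ ℝ, μ] G) x‖ₑ ∂μ
      ≤ ∫⁻ x, ∫⁻ t, ‖lsmul ℝ ℝ (φ.normed μ t) (G (x - t))‖ₑ ∂μ ∂μ :=
        lintegral_mono fun x => enorm_integral_le_lintegral_enorm _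
    _ = ∫⁻ t, ∫⁻ x, ‖lsmul ℝ ℝ (φ.normed μ t) (G (x - t))‖ₑ ∂μ ∂μ :=
        lintegral_lintegral_swap (hφm.convolution_integrand (lsmul ℝ ℝ) hG).enorm
    _ = ∫⁻ t, ‖φ.normed μ t‖ₑ * ∫⁻ x, ‖G x‖ₑ ∂μ ∂μ := by
        congr 1 with t
        simp only [lsmul_apply, enorm_smul]
        rw [lintegral_const_mul' _ _ enorm_ne_top,
          lintegral_sub_right_eq_self (fun x => ‖G x‖ₑ) t]
    _ = ∫⁻ x, ‖G x‖ₑ ∂μ := by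
        rw [lintegral_mul_const'' _ hφm.enorm, hφ, one_mul]

/-- `G` is a weak derivative on the whole space of `u`, tested against smooth compactly supported
functions. -/
def IsWeakDeriv (μ : Measure V) (u : V → F) (G : V → V →L[ℝ] F) : Prop :=
  ∀ φ : V → ℝ, ContDiff ℝ ∞ φ → HasCompactSupport φ → ∀ v : V,
    ∫ x, (fderiv ℝ φ x v) • u x ∂μ = - ∫ x, φ x • G x v ∂μ

theorem IsWeakDeriv.hasFDerivAt_convolution {u : V → F} {G : V → V →L[ℝ] F}
    (h : IsWeakDeriv μ u G) (hu : Integrable u μ) (hG : Integrable G μ) {φ : V → ℝ}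
    (hφ : ContDiff ℝ ∞ φ) (hφc : HasCompactSupport φ) (x : V) :
    HasFDerivAt (φ ⋆[lsmul ℝ ℝ, μ] u) ((φ ⋆[lsmul ℝ ℝ, μ] G) x) x := by
  have hφ1 : ContDiff ℝ 1 φ := hφ.of_le (by exact_mod_cast le_top)
  have hd := hφc.hasFDerivAt_convolution_left (lsmul ℝ ℝ) hφ1 hu.locallyIntegrable x
  convert hd using 1
  ext v
  have e1 := (hφc.fderiv ℝ).convolutionExists_left (μ := μ)
    ((lsmul ℝ ℝ : ℝ →L[ℝ] F →L[ℝ] F).precompL V)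
    (hφ1.continuous_fderiv (by norm_num)) hu.locallyIntegrable x
  have e2 := hφc.convolutionExists_left (μ := μ) (lsmul ℝ ℝ : ℝ →L[ℝ] (V →L[ℝ] F) →L[ℝ] _)
    hφ1.continuous hG.locallyIntegrable x
  rw [convolution_eq_swap, convolution_eq_swap,
    ContinuousLinearMap.integral_apply e2.integrable_swap,
    ContinuousLinearMap.integral_apply e1.integrable_swap]
  -- The weak derivative identity is tested on the reflected translate `t ↦ φ (x - t)`, whose
  -- chain-rule sign cancels the minus sign of integration by parts.
  have hψ : ContDiff ℝ ∞ fun t => φ (x - t) := hφ.comp (contDiff_const.sub contDiff_id)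
  have hψc : HasCompactSupport fun t => φ (x - t) :=
    hφc.comp_homeomorph (Homeomorph.subLeft x)
  have hw := h _ hψ hψc v
  have hder : ∀ t, fderiv ℝ (fun t => φ (x - t)) t v = - fderiv ℝ φ (x - t) v := by
    intro t
    have h1 : HasFDerivAt (fun t : V => x - t) (-ContinuousLinearMap.id ℝ V) t :=
      (hasFDerivAt_id t).const_sub x
    have h2 := ((hφ1.differentiable (by norm_num)) (x - t)).hasFDerivAt.comp t h1
    have h3 : fderiv ℝ (fun t => φ (x - t)) t = _ := h2.fderiv
    rw [h3]
    simp
  simp only [hder, neg_smul, integral_neg, neg_inj] at hw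
  simpa using hw.symm

end Mollification

/-! ### Differentiability on large sets -/

section LusinDifferentiability

open Metric Module Filter Topology ContinuousLinearMap
open scoped Convolution

/-- If `C¹` maps `w k` converge to `u` on `S` together with their derivatives, and consecutive
differences have small Lipschitz constants on `S` at unit scale, then `u` is differentiable within
`S`. -/
theorem hasFDerivWithinAt_of_lipschitz_approx {V F : Type*} [NormedAddCommGroup V]
    [NormedSpace ℝ V] [NormedAddCommGroup F] [NormedSpace ℝ F]
    {w : ℕ → V → F} {u : V → F} {G : V → V →L[ℝ] F}
    {S : Set V} {C : ℝ} {m : ℕ} (hw : ∀ k, ContDiff ℝ 1 (w k))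
    (hlip : ∀ k ≥ m, ∀ x ∈ S, ∀ y ∈ S, dist x y ≤ 1 →
      ‖(w k - w (k + 1)) x - (w k - w (k + 1)) y‖ ≤ C * 2⁻¹ ^ k * dist x y)
    (hu : ∀ x ∈ S, Tendsto (fun k => w k x) atTop (𝓝 (u x)))
    (hG : ∀ x ∈ S, Tendsto (fun k => fderiv ℝ (w k) x) atTop (𝓝 (G x))) {x : V} (hx : x ∈ S) :
    HasFDerivWithinAt u (G x) S x := by
  have hdiff : ∀ k ≥ m, ∀ y ∈ S, dist y x ≤ 1 →
      ‖(w k y - w k x) - (u y - u x)‖ ≤ 2 * C * 2⁻¹ ^ k * ‖y - x‖ := by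
    intro k hk y hy hyx
    -- Telescoping over the tail `k, k + 1, …`: the Lipschitz constants form a geometric series with
    -- sum `2 * C * 2⁻¹ ^ k`.
    have := dist_le_of_le_geometric_two_of_tendsto₀
      (f := fun j => w (k + j) y - w (k + j) x) (a := u y - u x)
      (C := 2 * C * 2⁻¹ ^ k * ‖y - x‖) ?_ ?_
    · simpa [dist_eq_norm] using this
    · intro j
      have h1 := hlip (k + j) (by omega) y hy x hx hyx
      rw [dist_eq_norm]
      have h2 : w (k + j) y - w (k + j) x - (w (k + (j + 1)) y - w (k + (j + 1)) x)
          = (w (k + j) - w (k + j + 1)) y - (w (k + j) - w (k + j + 1)) x := by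
        simp only [Pi.sub_apply, add_assoc]; abel
      rw [h2]
      refine h1.trans_eq ?_
      rw [dist_eq_norm, pow_add, inv_pow, inv_pow]
      field_simp
    · have ht : Tendsto (fun j => k + j) atTop atTop := tendsto_atTop_mono (fun j => Nat.le_add_left j k) tendsto_id
      exact ((hu y hy).comp ht).sub ((hu x hx).comp ht)
  rw [hasFDerivWithinAt_iff_isLittleO, Asymptotics.isLittleO_iff]
  intro c hc
  have hE1 : ∀ᶠ k in atTop, 2 * C * (2⁻¹ : ℝ) ^ k < c / 3 := by
    have : Tendsto (fun k : ℕ => 2 * C * (2⁻¹ : ℝ) ^ k) atTop (𝓝 (2 * C * 0)) :=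
      (tendsto_pow_atTop_nhds_zero_of_lt_one (by norm_num) (by norm_num)).const_mul _
    exact this.eventually_lt_const (by simpa using by positivity)
  have hE2 : ∀ᶠ k in atTop, ‖fderiv ℝ (w k) x - G x‖ < c / 3 := by
    have := ((hG x hx).sub_const (G x)).norm
    rw [sub_self, norm_zero] at this
    exact this.eventually_lt_const (by positivity)
  obtain ⟨k, hk1, hk2, hkm⟩ := (hE1.and (hE2.and (eventually_ge_atTop m))).exists
  have hwk := ((hw k).differentiable (by norm_num) x).hasFDerivAt
  rw [hasFDerivAt_iff_isLittleO, Asymptotics.isLittleO_iff] at hwk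
  filter_upwards [nhdsWithin_le_nhds (hwk (show 0 < c / 3 by positivity)), self_mem_nhdsWithin,
    nhdsWithin_le_nhds (closedBall_mem_nhds x one_pos)] with y hy1 hyS hy2
  have a1 := hdiff k hkm y hyS hy2
  have a2 : ‖(fderiv ℝ (w k) x - G x) (y - x)‖ ≤ c / 3 * ‖y - x‖ :=
    (le_opNorm _ _).trans (by gcongr)
  have a3 : 2 * C * 2⁻¹ ^ k * ‖y - x‖ ≤ c / 3 * ‖y - x‖ := by gcongr
  have key : u y - u x - (G x) (y - x)
      = (w k y - w k x - fderiv ℝ (w k) x (y - x)) + (fderiv ℝ (w k) x - G x) (y - x)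
        - ((w k y - w k x) - (u y - u x)) := by
    simp only [sub_apply]; abel
  rw [key]
  refine (norm_sub_le _ _).trans ((add_le_add_left (norm_add_le _ _) _).trans ?_)
  linarith

variable {V : Type*} [NormedAddCommGroup V] [NormedSpace ℝ V] [FiniteDimensional ℝ V]
  [MeasurableSpace V] [BorelSpace V] {μ : Measure V} [μ.IsAddHaarMeasure]
  {F : Type*} [NormedAddCommGroup F] [NormedSpace ℝ F]

/-- Fast approximation of a weakly differentiable map by `C¹` maps. -/
theorem IsWeakDeriv.exists_seq_contDiff [CompleteSpace F] {u : V → F} {G : V → V →L[ℝ] F}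
    (h : IsWeakDeriv μ u G) (hu : Integrable u μ) (hG : Integrable G μ) :
    ∃ w : ℕ → V → F, (∀ k, ContDiff ℝ 1 (w k)) ∧
      (∀ k, ∫⁻ x, ‖fderiv ℝ (w k) x - G x‖ₑ ∂μ ≤ 4⁻¹ ^ k) ∧
      (∀ᵐ x ∂μ, Tendsto (fun k => w k x) atTop (𝓝 (u x))) ∧
      (∀ᵐ x ∂μ, Tendsto (fun k => fderiv ℝ (w k) x) atTop (𝓝 (G x))) := by
  let φ : ℕ → ContDiffBump (0 : V) := fun k =>
    ⟨1 / ((k : ℝ) + 1), 2 * (1 / ((k : ℝ) + 1)), by positivity, by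
      have : 0 < 1 / ((k : ℝ) + 1) := by positivity
      linarith⟩
  have hrOut : Tendsto (fun k => (φ k).rOut) atTop (𝓝 0) := by
    have h := tendsto_one_div_add_atTop_nhds_zero_nat.const_mul (2 : ℝ)
    rwa [mul_zero] at h
  have hratio : ∀ᶠ k in atTop, (φ k).rOut ≤ 2 * (φ k).rIn := Eventually.of_forall fun k => le_rfl
  set v : ℕ → V → F := fun k => (φ k).normed μ ⋆[lsmul ℝ ℝ, μ] u with hv
  have hφs : ∀ k, ContDiff ℝ ∞ ((φ k).normed μ) := fun k => (φ k).contDiff_normed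
  have hφc : ∀ k, HasCompactSupport ((φ k).normed μ) := fun k => (φ k).hasCompactSupport_normed
  have hφ1 : ∀ k, ContDiff ℝ 1 ((φ k).normed μ) := fun k =>
    (hφs k).of_le (by exact_mod_cast le_top)
  have hvd : ∀ k, ContDiff ℝ 1 (v k) := fun k =>
    (hφc k).contDiff_convolution_left (lsmul ℝ ℝ) (hφ1 k) hu.locallyIntegrable
  have hfd : ∀ k, fderiv ℝ (v k) = (φ k).normed μ ⋆[lsmul ℝ ℝ, μ] G := fun k =>
    funext fun x => (h.hasFDerivAt_convolution hu hG (hφs k) (hφc k) x).fderiv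
  have hlim_u : ∀ᵐ x ∂μ, Tendsto (fun k => v k x) atTop (𝓝 (u x)) :=
    ContDiffBump.ae_convolution_tendsto_right_of_locallyIntegrable hrOut hratio
      hu.locallyIntegrable
  have hlim_G : ∀ᵐ x ∂μ, Tendsto (fun k => fderiv ℝ (v k) x) atTop (𝓝 (G x)) := by
    simp only [hfd]
    exact ContDiffBump.ae_convolution_tendsto_right_of_locallyIntegrable hrOut hratio
      hG.locallyIntegrable
  have hL1 : Tendsto (fun k => ∫⁻ x, ‖fderiv ℝ (v k) x - G x‖ₑ ∂μ) atTop (𝓝 0) := by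
    refine tendsto_lintegral_enorm_sub_of_ae_tendsto hG
      (fun k => ((hvd k).continuous_fderiv (by norm_num)).aestronglyMeasurable) (fun k => ?_) hlim_G
    rw [hfd k]
    exact lintegral_enorm_convolution_normed_le (φ k) hG.1
  -- The rate `4⁻¹ ^ m` is chosen so that the weak type bound at height `2⁻¹ ^ m` still leaves a
  -- summable `2⁻¹ ^ m`.
  obtain ⟨σ, hσ, hσ'⟩ := extraction_forall_of_eventually
    (P := fun m k => ∫⁻ x, ‖fderiv ℝ (v k) x - G x‖ₑ ∂μ ≤ 4⁻¹ ^ m)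
    (fun m => ENNReal.tendsto_nhds_zero.1 hL1 _ (ENNReal.pow_pos (by simp) m))
  refine ⟨fun k => v (σ k), fun k => hvd _, hσ', ?_, ?_⟩
  · filter_upwards [hlim_u] with x hx using hx.comp hσ.tendsto_atTop
  · filter_upwards [hlim_G] with x hx using hx.comp hσ.tendsto_atTop

/-- If the derivatives of `C¹` maps converge fast in `L¹`, then outside of a set of finite total
measure the local maximal functions of consecutive differences decay geometrically. -/
theorem tsum_measure_maximalSuperlevel_ne_top {w : ℕ → V → F} {G : V → V →L[ℝ] F}
    (hw : ∀ k, ContDiff ℝ 1 (w k))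
    (hL : ∀ k, ∫⁻ x, ‖fderiv ℝ (w k) x - G x‖ₑ ∂μ ≤ 4⁻¹ ^ k) (hG : AEStronglyMeasurable G μ) :
    ∑' k, μ (maximalSuperlevel μ (fun x => ‖fderiv ℝ (w k - w (k + 1)) x‖ₑ) (2⁻¹ ^ k)) ≠ ⊤ := by
  set D := ENNReal.ofReal (4 ^ finrank ℝ V)
  have hle : ∀ k, μ (maximalSuperlevel μ (fun x => ‖fderiv ℝ (w k - w (k + 1)) x‖ₑ) (2⁻¹ ^ k))
      ≤ D * 2 * 2⁻¹ ^ k := by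
    intro k
    have h1 := mul_measure_maximalSuperlevel_le μ
      (fun x => ‖fderiv ℝ (w k - w (k + 1)) x‖ₑ) (2⁻¹ ^ k)
    have h2 : ∫⁻ x, ‖fderiv ℝ (w k - w (k + 1)) x‖ₑ ∂μ ≤ 2 * 4⁻¹ ^ k := by
      calc ∫⁻ x, ‖fderiv ℝ (w k - w (k + 1)) x‖ₑ ∂μ
          ≤ ∫⁻ x, (‖fderiv ℝ (w k) x - G x‖ₑ + ‖fderiv ℝ (w (k + 1)) x - G x‖ₑ) ∂μ := by
            refine lintegral_mono fun x => ?_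
            rw [fderiv_sub ((hw k).differentiable (by norm_num) x)
              ((hw (k + 1)).differentiable (by norm_num) x)]
            have : fderiv ℝ (w k) x - fderiv ℝ (w (k + 1)) x
              = (fderiv ℝ (w k) x - G x) - (fderiv ℝ (w (k + 1)) x - G x) := by abel
            rw [this]
            exact enorm_sub_le
        _ = ∫⁻ x, ‖fderiv ℝ (w k) x - G x‖ₑ ∂μ + ∫⁻ x, ‖fderiv ℝ (w (k + 1)) x - G x‖ₑ ∂μ :=
            lintegral_add_left' (((hw k).continuous_fderiv
              (by norm_num)).aestronglyMeasurable.sub hG).enorm _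
        _ ≤ 4⁻¹ ^ k + 4⁻¹ ^ (k + 1) := add_le_add (hL k) (hL (k + 1))
        _ ≤ 4⁻¹ ^ k + 4⁻¹ ^ k := by
            exact add_le_add le_rfl (pow_le_pow_of_le_one zero_le (by simp) (Nat.le_succ k))
        _ = 2 * 4⁻¹ ^ k := by ring
    have h22 : (2 : ℝ≥0∞) ^ k * 2⁻¹ ^ k = 1 := by
      rw [← mul_pow, ENNReal.mul_inv_cancel (by simp) (by simp), one_pow]
    have h4 : (4⁻¹ : ℝ≥0∞) ^ k = 2⁻¹ ^ k * 2⁻¹ ^ k := by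
      rw [← mul_pow, ← ENNReal.mul_inv (by simp) (by simp)]
      norm_num
    set A := μ (maximalSuperlevel μ (fun x => ‖fderiv ℝ (w k - w (k + 1)) x‖ₑ) (2⁻¹ ^ k))
    calc A = 2 ^ k * (2⁻¹ ^ k * A) := by rw [← mul_assoc, h22, one_mul]
      _ ≤ 2 ^ k * (D * (2 * 4⁻¹ ^ k)) := 
        mul_le_mul_right (h1.trans (mul_le_mul_right h2 _)) _
      _ = D * 2 * 2⁻¹ ^ k * (2 ^ k * 2⁻¹ ^ k) := by rw [h4]; ring
      _ = _ := by rw [h22, mul_one]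
  refine ne_top_of_le_ne_top ?_ (ENNReal.tsum_le_tsum hle)
  rw [ENNReal.tsum_mul_left, ENNReal.tsum_geometric, ENNReal.one_sub_inv_two, inv_inv]
  exact ENNReal.mul_ne_top (ENNReal.mul_ne_top ENNReal.ofReal_ne_top (by simp)) (by simp)

variable [CompleteSpace F]

/-- An integrable map with an integrable weak derivative is, on each of countably many measurable
sets exhausting almost all of the space, differentiable within the set with derivative given by
the weak derivative. -/
theorem IsWeakDeriv.exists_exhaustion_hasFDerivWithinAt {u : V → F} {G : V → V →L[ℝ] F}
    (h : IsWeakDeriv μ u G) (hu : Integrable u μ) (hG : Integrable G μ) :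
    ∃ S : ℕ → Set V, (∀ m, MeasurableSet (S m)) ∧ Monotone S ∧ (∀ᵐ x ∂μ, ∃ m, x ∈ S m) ∧
      ∀ m, ∀ x ∈ S m, HasFDerivWithinAt u (G x) (S m) x := by
  obtain ⟨w, hw, hL, hlu, hlG⟩ := h.exists_seq_contDiff hu hG
  set B : ℕ → Set V := fun k =>
    maximalSuperlevel μ (fun x => ‖fderiv ℝ (w k - w (k + 1)) x‖ₑ) (2⁻¹ ^ k)
  -- Measurable hulls have the same measure and keep the exhausting sets measurable.
  set B' : ℕ → Set V := fun k => toMeasurable μ (B k)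
  have hsum : ∑' k, μ (B' k) ≠ ⊤ := by
    simpa only [B', measure_toMeasurable] using tsum_measure_maximalSuperlevel_ne_top hw hL hG.1
  have hfin : ∀ᵐ x ∂μ, ∀ᶠ k in atTop, x ∉ B' k := ae_eventually_notMem hsum
  obtain ⟨Z, hZsub, hZm, hZ0⟩ := exists_measurable_superset_of_null (hlu.and hlG)
  have hZ : ∀ x ∉ Z, Tendsto (fun k => w k x) atTop (𝓝 (u x)) ∧
      Tendsto (fun k => fderiv ℝ (w k) x) atTop (𝓝 (G x)) := by
    intro x hx
    by_contra hcon
    exact hx (hZsub hcon)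
  refine ⟨fun m => Zᶜ ∩ ⋂ k ≥ m, (B' k)ᶜ, fun m => ?_, fun a b hab => ?_, ?_, fun m x hx => ?_⟩
  · exact hZm.compl.inter (MeasurableSet.biInter (to_countable _)
      fun k _ => (measurableSet_toMeasurable μ _).compl)
  · refine inter_subset_inter_right _ fun x hx => ?_
    simp only [mem_iInter] at hx ⊢
    exact fun k hk => hx k (hab.trans hk)
  · filter_upwards [hfin, measure_eq_zero_iff_ae_notMem.1 hZ0] with x hx hxZ
    obtain ⟨m, hm⟩ := eventually_atTop.1 hx
    exact ⟨m, hxZ, mem_iInter₂.2 hm⟩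
  · refine hasFDerivWithinAt_of_lipschitz_approx (C := 2 ^ (finrank ℝ V + 1)) (m := m) hw ?_
      (fun y hy => (hZ y hy.1).1) (fun y hy => (hZ y hy.1).2) hx
    intro k hk y hy z hz hyz
    have hB : ∀ a ∈ Zᶜ ∩ ⋂ k ≥ m, (B' k)ᶜ, a ∉ B k := fun a ha haB => by
      have := ha.2
      simp only [mem_iInter] at this
      exact this k hk (subset_toMeasurable μ _ haB)
    have key := enorm_sub_le_of_notMem_maximalSuperlevel μ ((hw k).sub (hw (k + 1))) hyz
      (hB y hy) (hB z hz)
    have hconv : (2 : ℝ≥0∞) ^ (finrank ℝ V + 1) * 2⁻¹ ^ k * ENNReal.ofReal (dist y z)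
        = ENNReal.ofReal (2 ^ (finrank ℝ V + 1) * 2⁻¹ ^ k * dist y z) := by
      rw [ENNReal.ofReal_mul (by positivity), ENNReal.ofReal_mul (by positivity),
        ENNReal.ofReal_pow (by norm_num), ENNReal.ofReal_pow (by norm_num),
        ENNReal.ofReal_inv_of_pos (by norm_num), ENNReal.ofReal_ofNat]
    rw [hconv, ← ofReal_norm] at key
    exact (ENNReal.ofReal_le_ofReal_iff (by positivity)).1 key

end LusinDifferentiability

/-! ### Area inequality with multiplicity -/

section AreaInequality

open Metric Module Filter Topology
open scoped NNReal

/-- One preimage of `y` can be chosen in each piece whose image contains `y`; disjointness of the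
pieces makes the choices distinct. -/
theorem tsum_indicator_image_le_encard {α β : Type*} {f : α → β} {S : Set α} {t : ℕ → Set α}
    (ht : Pairwise (Function.onFun Disjoint t)) (y : β) :
    ∑' k, (f '' (S ∩ t k)).indicator (fun _ => (1 : ℝ≥0∞)) y
      ≤ ({x | x ∈ S ∧ f x = y}.encard : ℝ≥0∞) := by
  classical
  rw [ENNReal.tsum_eq_iSup_sum]
  refine iSup_le fun I => ?_
  rcases isEmpty_or_nonempty α with hα | hα
  · simp [Set.eq_empty_of_isEmpty]
  have hex : ∀ k, ∃ x, y ∈ f '' (S ∩ t k) → x ∈ S ∩ t k ∧ f x = y := by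
    intro k
    by_cases hk : y ∈ f '' (S ∩ t k)
    · obtain ⟨x, hx⟩ := hk
      exact ⟨x, fun _ => hx⟩
    · exact ⟨Classical.arbitrary α, fun h => absurd h hk⟩
  choose x hx using hex
  set J := I.filter fun k => y ∈ f '' (S ∩ t k)
  have hinj : Set.InjOn x J := by
    intro a ha b hb hab
    by_contra hne
    have ha' := (hx a (Finset.mem_filter.1 ha).2).1.2
    have hb' := (hx b (Finset.mem_filter.1 hb).2).1.2
    exact Set.disjoint_left.1 (ht hne) ha' (hab ▸ hb')
  have hsub : ((J.image x : Finset α) : Set α) ⊆ {x | x ∈ S ∧ f x = y} := by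
    intro z hz
    obtain ⟨k, hk, rfl⟩ := Finset.mem_image.1 (Finset.mem_coe.1 hz)
    have := hx k (Finset.mem_filter.1 hk).2
    exact ⟨this.1.1, this.2⟩
  have hcard := Set.encard_le_encard hsub
  rw [Set.encard_coe_eq_coe_finsetCard, Finset.card_image_of_injOn hinj] at hcard
  calc ∑ k ∈ I, (f '' (S ∩ t k)).indicator (fun _ => (1 : ℝ≥0∞)) y
      = (J.card : ℝ≥0∞) := by
        simp only [indicator_apply, Finset.sum_boole, J]
    _ ≤ _ := by exact_mod_cast ENat.toENNReal_le.2 hcard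

/-- There is a tolerance such that maps approximated to within it by an invertible linear map are
injective. -/
theorem exists_injOn_of_approximatesLinearOn {V : Type*} [NormedAddCommGroup V]
    [NormedSpace ℝ V] [FiniteDimensional ℝ V] (A : V →L[ℝ] V) :
    ∃ r : ℝ≥0, r ≠ 0 ∧ (A.det ≠ 0 → ∀ (f : V → V) (s : Set V),
      ApproximatesLinearOn f A s r → InjOn f s) := by
  by_cases hA : A.det = 0
  · exact ⟨1, one_ne_zero, fun h => absurd hA h⟩
  set B := A.toContinuousLinearEquivOfDetNeZero hA
  have hBA : (B : V →L[ℝ] V) = A := A.coe_toContinuousLinearEquivOfDetNeZero hA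
  rcases subsingleton_or_nontrivial V with hV | hV
  · exact ⟨1, one_ne_zero, fun _ f s _ => fun a _ b _ _ => Subsingleton.elim a b⟩
  set N := ‖(B.symm : V →L[ℝ] V)‖₊
  have hN : 0 < N := B.nnnorm_symm_pos
  refine ⟨N⁻¹ / 2, (by positivity), fun _ f s hfs => ?_⟩
  rw [← hBA] at hfs
  exact hfs.injOn (Or.inr (NNReal.half_lt_self (by positivity)))

variable {V : Type*} [NormedAddCommGroup V] [NormedSpace ℝ V] [FiniteDimensional ℝ V]
  [MeasurableSpace V] [BorelSpace V] (μ : Measure V) [μ.IsAddHaarMeasure]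

/-- The area inequality with multiplicity. -/
theorem lintegral_abs_det_le_mul_measure {f : V → V} {f' : V → V →L[ℝ] V} {S T : Set V}
    (hS : MeasurableSet S) (hf' : ∀ x ∈ S, HasFDerivWithinAt f (f' x) S x) (hm : Measurable f')
    {N : ℝ≥0∞} (hN : ∀ y, ({x | x ∈ S ∧ f x = y}.encard : ℝ≥0∞) ≤ N) (hT : MeasurableSet T)
    (hST : MapsTo f S T) :
    ∫⁻ x in S, ENNReal.ofReal |(f' x).det| ∂μ ≤ N * μ T := by
  have hdet : Measurable fun x => (f' x).det := ContinuousLinearMap.continuous_det.measurable.comp hm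
  -- Critical points contribute nothing to the integral. Off them the approximating linear maps are
  -- invertible, which gives injectivity on each piece.
  set R := S ∩ {x | (f' x).det ≠ 0} with hRdef
  have hR : MeasurableSet R := hS.inter (hdet (measurableSet_singleton 0).compl)
  have hRS : R ⊆ S := inter_subset_left
  have hSR : ∫⁻ x in S, ENNReal.ofReal |(f' x).det| ∂μ
      = ∫⁻ x in R, ENNReal.ofReal |(f' x).det| ∂μ := by
    rw [← lintegral_indicator hS, ← lintegral_indicator hR]
    congr 1 with x
    by_cases hxS : x ∈ S <;> by_cases hx0 : (f' x).det = 0 <;> simp [hRdef, hxS, hx0]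
  choose r hr0 hrinj using exists_injOn_of_approximatesLinearOn (V := V)
  have hfR : ∀ x ∈ R, HasFDerivWithinAt f (f' x) R x := fun x hx => (hf' x hx.1).mono hRS
  obtain ⟨t, A, htd, htm, htc, happ, hA⟩ :=
    exists_partition_approximatesLinearOn_of_hasFDerivWithinAt f R f' hfR r hr0
  rcases R.eq_empty_or_nonempty with hRe | hRne
  · rw [hSR, hRe]; simp
  have hinj : ∀ k, InjOn f (R ∩ t k) := by
    intro k
    obtain ⟨y, hy, hAy⟩ := hA hRne k
    exact hrinj (A k) (by rw [hAy]; exact hy.2) f _ (happ k)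
  have hfk : ∀ k, ∀ x ∈ R ∩ t k, HasFDerivWithinAt f (f' x) (R ∩ t k) x := fun k x hx =>
    (hfR x hx.1).mono inter_subset_left
  have hmk : ∀ k, MeasurableSet (R ∩ t k) := fun k => hR.inter (htm k)
  have himg : ∀ k, MeasurableSet (f '' (R ∩ t k)) := fun k =>
    measurable_image_of_fderivWithin (hmk k) (hfk k) (hinj k)
  have hRu : R = ⋃ k, R ∩ t k := by
    rw [← inter_iUnion, inter_eq_left.2 htc]
  calc ∫⁻ x in S, ENNReal.ofReal |(f' x).det| ∂μ
      = ∑' k, ∫⁻ x in R ∩ t k, ENNReal.ofReal |(f' x).det| ∂μ := by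
        rw [hSR]
        conv_lhs => rw [hRu]
        exact lintegral_iUnion hmk (fun i j hij =>
          (htd hij).mono inter_subset_right inter_subset_right) _
    _ = ∑' k, μ (f '' (R ∩ t k)) := by
        congr 1 with k
        exact lintegral_abs_det_fderiv_eq_addHaar_image μ (hmk k) (hfk k) (hinj k)
    _ = ∫⁻ y, ∑' k, (f '' (R ∩ t k)).indicator (fun _ => (1 : ℝ≥0∞)) y ∂μ := by
        rw [lintegral_tsum fun k => (measurable_const.indicator (himg k)).aemeasurable]
        congr 1 with k
        rw [lintegral_indicator (himg k)]
        simp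
    _ ≤ ∫⁻ y, T.indicator (fun _ => N) y ∂μ := by
        refine lintegral_mono fun y => ?_
        by_cases hy : y ∈ T
        · rw [indicator_of_mem hy]
          refine (tsum_indicator_image_le_encard htd y).trans (le_trans ?_ (hN y))
          refine ENat.toENNReal_le.2 (Set.encard_le_encard fun x hx => ⟨hRS hx.1, hx.2⟩)
        · have : ∀ k, y ∉ f '' (R ∩ t k) := by
            rintro k ⟨x, hx, rfl⟩
            exact hy (hST (hRS hx.1))
          simp [this]
    _ = N * μ T := by rw [lintegral_indicator hT, setLIntegral_const]

end AreaInequality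

/-! ### Jacobian of a weakly differentiable map on the ball -/

namespace QRMap

open Metric Module Filter Topology ContinuousLinearMap

variable {n : ℕ}

/-- The weak derivative of `η f` given by the product rule. -/
noncomputable def cutoffDeriv (η : E n → ℝ) (f : E n → E n) (Df : E n → E n →L[ℝ] E n) (x : E n) :
    E n →L[ℝ] E n :=
  η x • Df x + (fderiv ℝ η x).smulRight (f x)

section Cutoff

variable {Ω : Set (E n)} {f : E n → E n} {Df : E n → E n →L[ℝ] E n} {η : E n → ℝ}

theorem integrable_smul_of_locallyIntegrableOn {F : Type*} [NormedAddCommGroup F] [NormedSpace ℝ F]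
    {g : E n → F} (hg : LocallyIntegrableOn g Ω volume) (hη : Continuous η)
    (hηc : HasCompactSupport η) (hηΩ : tsupport η ⊆ Ω) : Integrable fun x => η x • g x := by
  have h := (hg.integrableOn_compact_subset hηΩ hηc).continuousOn_smul hη.continuousOn hηc
  refine (integrableOn_iff_integrable_of_support_subset fun x hx => ?_).1 h
  refine subset_tsupport η fun h0 => hx ?_
  simp [h0]

theorem integrable_fderiv_smulRight (hf : LocallyIntegrableOn f Ω volume) (hη : ContDiff ℝ ∞ η)
    (hηc : HasCompactSupport η) (hηΩ : tsupport η ⊆ Ω) :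
    Integrable fun x => (fderiv ℝ η x).smulRight (f x) := by
  have hc : Continuous (fderiv ℝ η) := hη.continuous_fderiv (by simp)
  obtain ⟨C, hC⟩ := hc.bounded_above_of_compact_support (hηc.fderiv ℝ)
  have h := ContinuousLinearMap.integrable_of_bilin_of_bdd_left
    (smulRightL ℝ (E n) (E n)) C hc.aestronglyMeasurable (ae_of_all _ hC)
    (hf.integrableOn_compact_subset hηΩ hηc)
  refine (integrableOn_iff_integrable_of_support_subset (s := tsupport η) fun x hx => ?_).1 h
  refine (tsupport_fderiv_subset ℝ (f := η)) (subset_tsupport _ fun h0 => hx ?_)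
  ext v
  simp [h0]

theorem HasWeakDerivOn.integrable_cutoffDeriv (h : HasWeakDerivOn Ω f Df) (hη : ContDiff ℝ ∞ η)
    (hηc : HasCompactSupport η) (hηΩ : tsupport η ⊆ Ω) : Integrable (cutoffDeriv η f Df) :=
  (integrable_smul_of_locallyIntegrableOn h.locallyIntegrable_deriv hη.continuous hηc hηΩ).add
    (integrable_fderiv_smulRight h.locallyIntegrable hη hηc hηΩ)

theorem HasWeakDerivOn.isWeakDeriv_cutoff (h : HasWeakDerivOn Ω f Df) (hη : ContDiff ℝ ∞ η)
    (hηc : HasCompactSupport η) (hηΩ : tsupport η ⊆ Ω) :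
    IsWeakDeriv volume (fun x => η x • f x) (cutoffDeriv η f Df) := by
  intro φ hφ hφc v
  have hF := integrable_smul_of_locallyIntegrableOn h.locallyIntegrable hη.continuous hηc hηΩ
  have hG1 := integrable_smul_of_locallyIntegrableOn h.locallyIntegrable_deriv hη.continuous
    hηc hηΩ
  have hG2 := integrable_fderiv_smulRight h.locallyIntegrable hη hηc hηΩ
  have hdφ : Continuous fun x => fderiv ℝ φ x v :=
    (hφ.continuous_fderiv (by simp)).clm_apply continuous_const
  have hdφc : HasCompactSupport fun x => fderiv ℝ φ x v := hφc.fderiv_apply ℝ v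
  have i1 : Integrable fun x => (fderiv ℝ φ x v) • (η x • f x) :=
    hF.locallyIntegrable.integrable_smul_left_of_hasCompactSupport hdφ hdφc
  have i2 : Integrable fun x => φ x • (η x • Df x v) :=
    (hG1.apply_continuousLinearMap v).locallyIntegrable.integrable_smul_left_of_hasCompactSupport
      hφ.continuous hφc
  have i3 : Integrable fun x => φ x • (fderiv ℝ η x v • f x) :=
    (hG2.apply_continuousLinearMap v).locallyIntegrable.integrable_smul_left_of_hasCompactSupport
      hφ.continuous hφc
  -- The product `φ η` is an admissible test function in `Ω`; Leibniz then moves the derivative of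
  -- `η` to the right-hand side.
  have hψ : ContDiff ℝ ∞ (fun x => φ x * η x) := hφ.mul hη
  have hψs : tsupport (fun x => φ x * η x) ⊆ tsupport η := tsupport_mul_subset_right
  have hw := h.integral_eq _ hψ (hφc.mul_right) (hψs.trans hηΩ) v
  have hder : ∀ x, fderiv ℝ (fun x => φ x * η x) x v
      = φ x * fderiv ℝ η x v + η x * fderiv ℝ φ x v := by
    intro x
    rw [fderiv_fun_mul (hφ.differentiable (by simp) x) (hη.differentiable (by simp) x)]
    simp
  have hη0 : ∀ x ∉ Ω, η x = 0 := fun x hx => image_eq_zero_of_notMem_tsupport fun h' => hx (hηΩ h')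
  have hdη0 : ∀ x ∉ Ω, fderiv ℝ η x = 0 := fun x hx =>
    image_eq_zero_of_notMem_tsupport fun h' => hx (hηΩ (tsupport_fderiv_subset ℝ h'))
  rw [setIntegral_eq_integral_of_forall_compl_eq_zero (fun x hx => by
      rw [hder, hη0 x hx, hdη0 x hx]; simp),
    setIntegral_eq_integral_of_forall_compl_eq_zero (fun x hx => by rw [hη0 x hx]; simp)] at hw
  have e1 : ∫ x, (fderiv ℝ (fun x => φ x * η x) x v) • f x
      = (∫ x, φ x • (fderiv ℝ η x v • f x)) + ∫ x, (fderiv ℝ φ x v) • (η x • f x) := by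
    rw [← integral_add i3 i1]
    congr 1 with x
    rw [hder, add_smul, smul_smul, smul_smul, mul_comm (η x)]
  have e2 : ∫ x, φ x • cutoffDeriv η f Df x v
      = (∫ x, φ x • (η x • Df x v)) + ∫ x, φ x • (fderiv ℝ η x v • f x) := by
    rw [← integral_add i2 i3]
    congr 1 with x
    simp [cutoffDeriv]
  have e3 : ∫ x, (φ x * η x) • Df x v = ∫ x, φ x • (η x • Df x v) := by
    congr 1 with x
    rw [smul_smul]
  rw [e1, e3] at hw
  rw [e2, neg_add, ← hw]
  abel

end Cutoff

/-- The Jacobian of a weakly differentiable map of the unit ball, bounded by `M`, is controlled by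
its multiplicity. -/
theorem HasWeakDerivOn.lintegral_abs_det_le {f : E n → E n} {Df : E n → E n →L[ℝ] E n}
    (h : HasWeakDerivOn (ball 0 1) f Df) {M : ℝ} (hM : ∀ x ∈ ball (0 : E n) 1, ‖f x‖ ≤ M)
    {r : ℝ} (hr0 : 0 < r) (hr1 : r < 1) :
    ∫⁻ x in ball (0 : E n) r, ENNReal.ofReal |(Df x).det|
      ≤ (multiplicity f (ball 0 r) : ℝ≥0∞) * volume (closedBall (0 : E n) M) := by
  let η : ContDiffBump (0 : E n) := ⟨r, (1 + r) / 2, hr0, by linarith⟩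
  have hη : ContDiff ℝ ∞ η := η.contDiff
  have hηc : HasCompactSupport η := η.hasCompactSupport
  have hηΩ : tsupport η ⊆ ball (0 : E n) 1 := by
    rw [η.tsupport_eq]
    exact closedBall_subset_ball (show (1 + r) / 2 < 1 by linarith)
  have hη1 : ∀ x ∈ ball (0 : E n) r, η x = 1 := fun x hx =>
    η.one_of_mem_closedBall (ball_subset_closedBall hx)
  have hG := h.integrable_cutoffDeriv hη hηc hηΩ
  have hGD : ∀ x ∈ ball (0 : E n) r, cutoffDeriv η f Df x = Df x := by
    intro x hx
    have h0 : fderiv ℝ η x = 0 := by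
      rw [(η.eventuallyEq_one_of_mem_ball hx).fderiv_eq]
      exact fderiv_const_apply _
    ext v
    simp [cutoffDeriv, hη1 x hx, h0]
  obtain ⟨S, hSm, hSmono, hSae, hSd⟩ := (h.isWeakDeriv_cutoff hη hηc hηΩ
    ).exists_exhaustion_hasFDerivWithinAt (integrable_smul_of_locallyIntegrableOn
      h.locallyIntegrable hη.continuous hηc hηΩ) hG
  -- The area inequality asks for a measurable derivative, so a measurable representative is used
  -- and the null set of disagreement is removed from the exhausting sets.
  set D := hG.1.mk (cutoffDeriv η f Df)
  have hDm : Measurable D := hG.1.stronglyMeasurable_mk.measurable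
  have hDae : cutoffDeriv η f Df =ᵐ[volume] D := hG.1.ae_eq_mk
  obtain ⟨Z, hZsub, hZm, hZ0⟩ := exists_measurable_superset_of_null hDae
  have hZ : ∀ x ∉ Z, cutoffDeriv η f Df x = D x := by
    intro x hx
    by_contra hcon
    exact hx (hZsub hcon)
  set A : ℕ → Set (E n) := fun m => S m ∩ (ball 0 r ∩ Zᶜ)
  have hAr : ∀ m, A m ⊆ ball 0 r := fun m x hx => hx.2.1
  have hAm : ∀ m, MeasurableSet (A m) := fun m =>
    (hSm m).inter (measurableSet_ball.inter hZm.compl)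
  have hAd : ∀ m, ∀ x ∈ A m, HasFDerivWithinAt f (D x) (A m) x := by
    intro m x hx
    rw [← hZ x hx.2.2]
    refine ((hSd m x hx.1).mono inter_subset_left).congr (fun y hy => ?_) ?_
    · simp [hη1 y (hAr m hy)]
    · simp [hη1 x (hAr m hx)]
  have hA : ∀ m, ∫⁻ x in A m, ENNReal.ofReal |(D x).det|
      ≤ (multiplicity f (ball 0 r) : ℝ≥0∞) * volume (closedBall (0 : E n) M) := by
    intro m
    refine lintegral_abs_det_le_mul_measure volume (hAm m) (hAd m) hDm (fun y => ?_)
      measurableSet_closedBall fun x hx => ?_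
    · refine ENat.toENNReal_le.2 (le_trans (Set.encard_le_encard fun x hx => ?_)
        (le_iSup (fun y => countPreimages y f (ball 0 r)) y))
      exact ⟨hAr m hx.1, hx.2⟩
    · simpa using hM x (ball_subset_ball hr1.le (hAr m hx))
  have hAmono : Monotone A := fun a b hab => inter_subset_inter_left _ (hSmono hab)
  calc ∫⁻ x in ball (0 : E n) r, ENNReal.ofReal |(Df x).det|
      = ∫⁻ x in ball (0 : E n) r, ENNReal.ofReal |(D x).det| := by
        refine setLIntegral_congr_fun_ae measurableSet_ball ?_
        filter_upwards [hDae] with x hx hxr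
        rw [← hx, hGD x hxr]
    _ ≤ ∫⁻ x in ⋃ m, A m, ENNReal.ofReal |(D x).det| := by
        refine lintegral_mono_set' ?_
        filter_upwards [hSae, measure_eq_zero_iff_ae_notMem.1 hZ0] with x ⟨m, hm⟩ hxZ hxr
        exact mem_iUnion.2 ⟨m, hm, hxr, hxZ⟩
    _ = ⨆ m, ∫⁻ x in A m, ENNReal.ofReal |(D x).det| :=
        setLIntegral_iUnion_of_directed _ hAmono.directed_le
    _ ≤ _ := iSup_le hA

/-- Weak derivatives are unique almost everywhere. -/
theorem HasWeakDerivOn.ae_eq {Ω : Set (E n)} (hΩ : IsOpen Ω) {f : E n → E n}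
    {D₁ D₂ : E n → E n →L[ℝ] E n} (h₁ : HasWeakDerivOn Ω f D₁) (h₂ : HasWeakDerivOn Ω f D₂) :
    ∀ᵐ x, x ∈ Ω → D₁ x = D₂ x := by
  have key := hΩ.ae_eq_zero_of_integral_contDiff_smul_eq_zero
    (h₁.locallyIntegrable_deriv.sub h₂.locallyIntegrable_deriv) ?_
  · filter_upwards [key] with x hx hxΩ using sub_eq_zero.1 (hx hxΩ)
  intro φ hφ hφc hφΩ
  have i1 := integrable_smul_of_locallyIntegrableOn h₁.locallyIntegrable_deriv hφ.continuous
    hφc hφΩ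
  have i2 := integrable_smul_of_locallyIntegrableOn h₂.locallyIntegrable_deriv hφ.continuous
    hφc hφΩ
  have hφ0 : ∀ x ∉ Ω, φ x = 0 := fun x hx => image_eq_zero_of_notMem_tsupport fun h' => hx (hφΩ h')
  have e : ∫ x, φ x • D₁ x = ∫ x, φ x • D₂ x := by
    ext1 v
    rw [ContinuousLinearMap.integral_apply i1, ContinuousLinearMap.integral_apply i2]
    have := (h₁.integral_eq φ hφ hφc hφΩ v).symm.trans (h₂.integral_eq φ hφ hφc hφΩ v)
    rw [neg_inj, setIntegral_eq_integral_of_forall_compl_eq_zero (fun x hx => by simp [hφ0 x hx]),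
      setIntegral_eq_integral_of_forall_compl_eq_zero (fun x hx => by simp [hφ0 x hx])] at this
    simpa using this
  simp only [Pi.sub_apply, smul_sub]
  rw [integral_sub i1 i2, e, sub_self]

end QRMap

/-! ### Dyadic rings, Hölder and the exponents -/

namespace QRMap

open Metric Module Filter Topology

variable {n : ℕ}

theorem dyadicRing_subset_closedBall_diff (j : ℕ) : dyadicRing n j ⊆
    closedBall 0 (1 - (2 : ℝ)⁻¹ ^ (j + 1)) \ closedBall 0 (1 - (2 : ℝ)⁻¹ ^ j) := by
  intro x hx
  simpa using And.intro hx.2 hx.1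

theorem measurableSet_dyadicRing (j : ℕ) : MeasurableSet (dyadicRing n j) :=
  (measurableSet_lt measurable_const measurable_norm).inter
    (measurableSet_le measurable_norm measurable_const)

theorem pairwise_disjoint_dyadicRing :
    Pairwise (Function.onFun Disjoint (dyadicRing n)) := by
  have hlt : ∀ i j : ℕ, i < j → Disjoint (dyadicRing n i) (dyadicRing n j) := by
    intro i j hij
    rw [Set.disjoint_left]
    intro x hi hj
    have h : (2 : ℝ)⁻¹ ^ j ≤ 2⁻¹ ^ (i + 1) :=
      pow_le_pow_of_le_one (by norm_num) (by norm_num) hij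
    have h1 := hi.2
    have h2 := hj.1
    linarith
  intro i j hij
  rcases lt_or_gt_of_ne hij with h | h
  · exact hlt i j h
  · exact (hlt j i h).symm

theorem exists_mem_dyadicRing {x : E n} (hx0 : x ≠ 0) (hx1 : ‖x‖ < 1) :
    ∃ j, x ∈ dyadicRing n j := by
  classical
  have hex : ∃ j : ℕ, ‖x‖ ≤ 1 - (2 : ℝ)⁻¹ ^ (j + 1) := by
    obtain ⟨j, hj⟩ := exists_pow_lt_of_lt_one (sub_pos.2 hx1) (show (2 : ℝ)⁻¹ < 1 by norm_num)
    refine ⟨j, ?_⟩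
    have : (2 : ℝ)⁻¹ ^ (j + 1) ≤ 2⁻¹ ^ j :=
      pow_le_pow_of_le_one (by norm_num) (by norm_num) (Nat.le_succ j)
    linarith
  -- Minimality of the index gives the strict inner inequality. For index `0` that inequality reads
  -- `0 < ‖x‖`, hence the exclusion of the origin.
  refine ⟨Nat.find hex, ?_, Nat.find_spec hex⟩
  rcases Nat.eq_zero_or_pos (Nat.find hex) with h0 | h0
  · rw [h0]
    simpa using hx0
  · have := Nat.find_min hex (Nat.sub_lt h0 one_pos)
    rw [show Nat.find hex - 1 + 1 = Nat.find hex by omega] at this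
    exact not_le.1 this

theorem weight_eq_of_mem {q : ℝ} {c : ℕ → ℝ} {j : ℕ} {x : E n} (hx : x ∈ dyadicRing n j) :
    weight n q c x = c j * |1 - ‖x‖| ^ (q - 1) := by
  rw [weight, tsum_eq_single j]
  · simp [hx]
  · intro i hij
    have : x ∉ dyadicRing n i := Set.disjoint_right.1 (pairwise_disjoint_dyadicRing hij) hx
    simp [this]

theorem weight_le_of_mem {q : ℝ} (hq : 1 < q) {c : ℕ → ℝ} {j : ℕ} (hc : 0 < c j) {x : E n}
    (hx : x ∈ dyadicRing n j) : weight n q c x ≤ c j * ((2 : ℝ) ^ j) ^ (-(q - 1)) := by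
  rw [weight_eq_of_mem hx, Real.rpow_neg (by positivity), ← Real.inv_rpow (by positivity)]
  have h1 := hx.1
  have h2 := hx.2
  have h3 : (0 : ℝ) < 2⁻¹ ^ (j + 1) := by positivity
  gcongr
  rw [abs_of_nonneg (by linarith), ← inv_pow]
  linarith

theorem pow_sub_pow_le_mul_sub {a b : ℝ} (hb : 0 ≤ b) (hba : b ≤ a) (ha : a ≤ 1) (k : ℕ) :
    a ^ k - b ^ k ≤ k * (a - b) := by
  induction k with
  | zero => simp
  | succ k ih =>
    have h1 : a ^ (k + 1) - b ^ (k + 1) = a * (a ^ k - b ^ k) + (a - b) * b ^ k := by ring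
    have h2 : b ^ k ≤ 1 := pow_le_one₀ hb (hba.trans ha)
    have h3 : 0 ≤ a ^ k - b ^ k := sub_nonneg.2 (pow_le_pow_left₀ hb hba k)
    have h4 : a * (a ^ k - b ^ k) ≤ a ^ k - b ^ k := mul_le_of_le_one_left h3 ha
    have h5 : (a - b) * b ^ k ≤ a - b := mul_le_of_le_one_right (sub_nonneg.2 hba) h2
    push_cast
    linarith

theorem volume_dyadicRing_le (j : ℕ) : volume (dyadicRing n j)
    ≤ ENNReal.ofReal (n * (volume (ball (0 : E n) 1)).toReal * ((2 : ℝ) ^ j)⁻¹) := by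
  set a : ℝ := 1 - (2 : ℝ)⁻¹ ^ (j + 1)
  set b : ℝ := 1 - (2 : ℝ)⁻¹ ^ j
  have hj : (0 : ℝ) < 2⁻¹ ^ j := by positivity
  have hj1 : (2 : ℝ)⁻¹ ^ j ≤ 1 := pow_le_one₀ (by norm_num) (by norm_num)
  have hab : a - b = 2⁻¹ ^ j / 2 := by simp only [a, b, pow_succ]; ring
  have hb : 0 ≤ b := by simp only [b]; linarith
  have hba : b ≤ a := by linarith
  have ha1 : a ≤ 1 := by
    have : (0 : ℝ) < 2⁻¹ ^ (j + 1) := by positivity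
    simp only [a]; linarith
  have hv : volume (ball (0 : E n) 1) ≠ ⊤ := measure_ball_lt_top.ne
  calc volume (dyadicRing n j)
      ≤ volume (closedBall (0 : E n) a \ closedBall 0 b) :=
        measure_mono (dyadicRing_subset_closedBall_diff j)
    _ = volume (closedBall (0 : E n) a) - volume (closedBall (0 : E n) b) :=
        measure_sdiff (closedBall_subset_closedBall hba) measurableSet_closedBall.nullMeasurableSet
          measure_closedBall_lt_top.ne
    _ = ENNReal.ofReal (a ^ n - b ^ n) * volume (ball (0 : E n) 1) := by
        rw [Measure.addHaar_closedBall _ _ (hb.trans hba), Measure.addHaar_closedBall _ _ hb,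
          finrank_euclideanSpace_fin, ← ENNReal.sub_mul (fun _ _ => hv),
          ENNReal.ofReal_sub _ (by positivity)]
    _ = ENNReal.ofReal ((a ^ n - b ^ n) * (volume (ball (0 : E n) 1)).toReal) := by
        rw [ENNReal.ofReal_mul (sub_nonneg.2 (pow_le_pow_left₀ hb hba n)), ENNReal.ofReal_toReal hv]
    _ ≤ _ := by
        refine ENNReal.ofReal_le_ofReal ?_
        have h1 := pow_sub_pow_le_mul_sub hb hba ha1 n
        have h2 : (n : ℝ) * (a - b) ≤ n * ((2 : ℝ) ^ j)⁻¹ := by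
          rw [hab, ← inv_pow]
          gcongr
          linarith
        calc (a ^ n - b ^ n) * (volume (ball (0 : E n) 1)).toReal
            ≤ (n * ((2 : ℝ) ^ j)⁻¹) * (volume (ball (0 : E n) 1)).toReal := by
              gcongr
              exact h1.trans h2
          _ = _ := by ring

/-- Hölder's inequality on a set, comparing the `q`-th and `n`-th powers of a norm. -/
theorem setLIntegral_enorm_rpow_le {α F : Type*} [MeasurableSpace α] {ν : Measure α}
    [NormedAddCommGroup F] {g : α → F} {s : Set α} (hg : AEStronglyMeasurable g (ν.restrict s))
    {q p : ℝ} (hq : 0 < q) (hqp : q < p) :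
    ∫⁻ x in s, ‖g x‖ₑ ^ q ∂ν ≤ (∫⁻ x in s, ‖g x‖ₑ ^ p ∂ν) ^ (q / p) * ν s ^ (1 - q / p) := by
  have hp : 0 < p := hq.trans hqp
  have hconj : (p / q).HolderConjugate (1 - q / p)⁻¹ := by
    have := Real.HolderConjugate.inv_inv (a := q / p) (b := 1 - q / p) (by positivity)
      (sub_pos.2 ((div_lt_one hp).2 hqp)) (by ring)
    rwa [inv_div] at this
  have h := ENNReal.lintegral_mul_le_Lp_mul_Lq (ν.restrict s) hconj
    (f := fun x => ‖g x‖ₑ ^ q) (g := fun _ => 1) (hg.enorm.pow_const q) aemeasurable_const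
  simp only [Pi.mul_apply, mul_one, ENNReal.one_rpow, lintegral_one, Measure.restrict_apply_univ,
    one_div, inv_inv, inv_div, ← ENNReal.rpow_mul] at h
  rwa [mul_div_cancel₀ p hq.ne'] at h

/-- With `X = 2^j`, `Y = j + 1` and `p = n`, the factors come from the weight, the `n`-energy and
the ring volume. The power of `X` is `-(q-1) + (p-1)q/p - (1-q/p) = 0`. -/
theorem rpow_cancel_exponents {A B X Y b q p : ℝ} (hA : 0 ≤ A) (hB : 0 ≤ B) (hX : 0 < X)
    (hY : 0 < Y) (hp : 0 < p) :
    X ^ (-(q - 1)) * (A * X ^ (p - 1) * Y ^ (-b)) ^ (q / p) * (B * X⁻¹) ^ (1 - q / p)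
      = A ^ (q / p) * B ^ (1 - q / p) * (Y ^ (b * (q / p)))⁻¹ := by
  rw [Real.mul_rpow (by positivity) (by positivity), Real.mul_rpow hA (by positivity),
    Real.mul_rpow hB (by positivity), ← Real.rpow_mul hX.le, ← Real.rpow_mul hY.le,
    ← Real.rpow_neg_one X, ← Real.rpow_mul hX.le, ← Real.rpow_neg hY.le, neg_mul]
  have h : X ^ (-(q - 1)) * X ^ ((p - 1) * (q / p)) * X ^ (-1 * (1 - q / p)) = 1 := by
    rw [← Real.rpow_add hX, ← Real.rpow_add hX]
    have : -(q - 1) + (p - 1) * (q / p) + -1 * (1 - q / p) = 0 := by field_simp; ring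
    rw [this, Real.rpow_zero]
  linear_combination A ^ (q / p) * B ^ (1 - q / p) * Y ^ (-(b * (q / p))) * h

/-- At `1 - r = 2^{-(j+2)}` one has `1 / (1 - r) = 4 · 2^j`, and the logarithm `(j + 2) log 2` is at
least `(j + 1) / 2`. The absolute value appears because `C` has no assumed sign. -/
theorem multiplicity_bound_dyadic {b C : ℝ} (hb : 0 < b) (n j : ℕ) :
    C * (1 - (1 - (2 : ℝ)⁻¹ ^ (j + 2))) ^ (-((n : ℝ) - 1))
        * (1 / Real.log (1 / (1 - (1 - (2 : ℝ)⁻¹ ^ (j + 2))))) ^ b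
      ≤ |C| * (4 ^ ((n : ℝ) - 1) * 2 ^ b) * ((2 : ℝ) ^ j) ^ ((n : ℝ) - 1)
        * ((j : ℝ) + 1) ^ (-b) := by
  have hlog : Real.log (1 / (1 - (1 - (2 : ℝ)⁻¹ ^ (j + 2)))) = (j + 2) * Real.log 2 := by
    rw [sub_sub_cancel, one_div, inv_pow, inv_inv, Real.log_pow]
    push_cast
    ring
  have hl2 : (1 : ℝ) / 2 < Real.log 2 := by linarith [Real.log_two_gt_d9]
  have h1 : (1 - (1 - (2 : ℝ)⁻¹ ^ (j + 2))) ^ (-((n : ℝ) - 1))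
      = 4 ^ ((n : ℝ) - 1) * ((2 : ℝ) ^ j) ^ ((n : ℝ) - 1) := by
    rw [sub_sub_cancel, Real.rpow_neg (by positivity), ← Real.inv_rpow (by positivity), inv_pow,
      inv_inv, ← Real.mul_rpow (by norm_num) (by positivity), pow_add, mul_comm]
    norm_num
  have h2 : (1 / Real.log (1 / (1 - (1 - (2 : ℝ)⁻¹ ^ (j + 2))))) ^ b
      ≤ 2 ^ b * ((j : ℝ) + 1) ^ (-b) := by
    rw [hlog, Real.rpow_neg (by positivity), ← Real.inv_rpow (by positivity),
      ← Real.mul_rpow (by norm_num) (by positivity)]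
    refine Real.rpow_le_rpow (by positivity) ?_ hb.le
    rw [← div_eq_mul_inv, div_le_div_iff₀ (by positivity) (by positivity)]
    nlinarith [Nat.cast_nonneg (α := ℝ) j]
  rw [h1]
  calc C * (4 ^ ((n : ℝ) - 1) * ((2 : ℝ) ^ j) ^ ((n : ℝ) - 1))
        * (1 / Real.log (1 / (1 - (1 - (2 : ℝ)⁻¹ ^ (j + 2))))) ^ b
      ≤ |C| * (4 ^ ((n : ℝ) - 1) * ((2 : ℝ) ^ j) ^ ((n : ℝ) - 1))
        * (2 ^ b * ((j : ℝ) + 1) ^ (-b)) := by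
        have hpos : 0 ≤ (1 / Real.log (1 / (1 - (1 - (2 : ℝ)⁻¹ ^ (j + 2))))) ^ b := by
          rw [hlog]; positivity
        gcongr
        exact le_abs_self C
    _ = _ := by ring

end QRMap

/-! ### Energy on rings and summation -/

namespace QRMap

open Metric Module Filter Topology

variable {n : ℕ}

/-- The `n`-energy of a bounded quasiregular map on a dyadic ring, when its multiplicity grows at
the prescribed rate. -/
theorem HasWeakDerivOn.lintegral_dyadicRing_le {b C K M : ℝ} (hb : 0 < b) {f : E n → E n}
    {Df : E n → E n →L[ℝ] E n} (h : HasWeakDerivOn (ball 0 1) f Df)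
    (hK : ∀ᵐ x, x ∈ ball (0 : E n) 1 → ‖Df x‖ ^ n ≤ K * (Df x).det)
    (hM : ∀ x ∈ ball (0 : E n) 1, ‖f x‖ ≤ M)
    (hN : ∀ r : ℝ, 0 < r → r < 1 → (multiplicity f (ball 0 r) : ℝ≥0∞) ≤
        ENNReal.ofReal (C * (1 - r) ^ (-((n : ℝ) - 1)) * (1 / Real.log (1 / (1 - r))) ^ b))
    (j : ℕ) :
    ∫⁻ x in dyadicRing n j, ‖Df x‖ₑ ^ (n : ℝ) ≤
      ENNReal.ofReal (|K| * (|C| * (4 ^ ((n : ℝ) - 1) * 2 ^ b))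
        * (volume (closedBall (0 : E n) M)).toReal * ((2 : ℝ) ^ j) ^ ((n : ℝ) - 1)
        * ((j : ℝ) + 1) ^ (-b)) := by
  -- The ring contains its outer sphere, of radius `1 - 2^{-(j+1)}`, so the open ball must reach one
  -- dyadic step further.
  set r : ℝ := 1 - (2 : ℝ)⁻¹ ^ (j + 2) with hr
  have hp : (0 : ℝ) < 2⁻¹ ^ (j + 2) := by positivity
  have hr1 : r < 1 := by linarith
  have hr0 : 0 < r := by
    have : (2 : ℝ)⁻¹ ^ (j + 2) < 1 := pow_lt_one₀ (by norm_num) (by norm_num) (by omega)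
    linarith
  have hsub : dyadicRing n j ⊆ ball 0 r := by
    intro x hx
    have h2 := hx.2
    have : (2 : ℝ)⁻¹ ^ (j + 2) < 2⁻¹ ^ (j + 1) :=
      pow_lt_pow_right_of_lt_one₀ (by norm_num) (by norm_num) (by omega)
    rw [mem_ball_zero_iff]
    linarith
  have hv : volume (closedBall (0 : E n) M) ≠ ⊤ := measure_closedBall_lt_top.ne
  calc ∫⁻ x in dyadicRing n j, ‖Df x‖ₑ ^ (n : ℝ)
      ≤ ∫⁻ x in ball (0 : E n) r, ‖Df x‖ₑ ^ (n : ℝ) := lintegral_mono_set hsub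
    _ ≤ ∫⁻ x in ball (0 : E n) r, ENNReal.ofReal |K| * ENNReal.ofReal |(Df x).det| := by
        refine setLIntegral_mono_ae' measurableSet_ball ?_
        filter_upwards [hK] with x hx hxr
        rw [ENNReal.rpow_natCast, ← ofReal_norm, ← ENNReal.ofReal_pow (norm_nonneg _),
          ← ENNReal.ofReal_mul (abs_nonneg _), ← abs_mul]
        exact ENNReal.ofReal_le_ofReal
          ((hx (ball_subset_ball hr1.le hxr)).trans (le_abs_self _))
    _ = ENNReal.ofReal |K| * ∫⁻ x in ball (0 : E n) r, ENNReal.ofReal |(Df x).det| :=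
        lintegral_const_mul' _ _ ENNReal.ofReal_ne_top
    _ ≤ ENNReal.ofReal |K| * (ENNReal.ofReal (|C| * (4 ^ ((n : ℝ) - 1) * 2 ^ b)
          * ((2 : ℝ) ^ j) ^ ((n : ℝ) - 1) * ((j : ℝ) + 1) ^ (-b))
          * volume (closedBall (0 : E n) M)) := by
        gcongr
        refine (h.lintegral_abs_det_le hM hr0 hr1).trans ?_
        gcongr
        exact (hN r hr0 hr1).trans (ENNReal.ofReal_le_ofReal (multiplicity_bound_dyadic hb n j))
    _ = _ := by
        conv_lhs => rw [← ENNReal.ofReal_toReal hv]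
        rw [← ENNReal.ofReal_mul (by positivity), ← ENNReal.ofReal_mul (by positivity)]
        congr 1
        ring

theorem lintegral_ball_le_tsum_dyadicRing (hn : n ≠ 0) (g : E n → ℝ≥0∞) :
    ∫⁻ x in ball (0 : E n) 1, g x ≤ ∑' j, ∫⁻ x in dyadicRing n j, g x := by
  have : NeZero n := ⟨hn⟩
  refine le_trans (lintegral_mono_set' ?_) (lintegral_iUnion_le (dyadicRing n) g)
  filter_upwards [Measure.ae_ne volume (0 : E n)] with x hx hx1
  exact mem_iUnion.2 (exists_mem_dyadicRing hx (mem_ball_zero_iff.1 hx1))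

end QRMap

theorem theorem3p1 (n : ℕ) (q b C : ℝ) (hq : 1 < q) (hqn : q < n) (hb : 0 < b)
    (f : QRMap.E n → QRMap.E n)
    (hf : QRMap.IsQuasiregularOn (Metric.ball 0 1) f)
    (hbdd : ∃ M : ℝ, ∀ x ∈ Metric.ball (0 : QRMap.E n) 1, ‖f x‖ ≤ M)
    (c : ℕ → ℝ) (hc : ∀ j, 0 < c j)
    (hsum : Summable fun j : ℕ => c (j + 1) / ((j + 1 : ℕ) : ℝ) ^ (b * (q / n)))
    (hN : ∀ r : ℝ, 0 < r → r < 1 →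
      (QRMap.multiplicity f (Metric.ball 0 r) : ENNReal) ≤
        ENNReal.ofReal (C * (1 - r) ^ (-((n : ℝ) - 1)) * (1 / Real.log (1 / (1 - r))) ^ b)) :
    ∀ Df : QRMap.E n → QRMap.E n →L[ℝ] QRMap.E n,
      QRMap.HasWeakDerivOn (Metric.ball 0 1) f Df →
        ∫⁻ x in Metric.ball (0 : QRMap.E n) 1,
          ENNReal.ofReal (‖Df x‖ ^ q * QRMap.weight n q c x) < ⊤ := by
  intro Df hDf
  obtain ⟨D, hD, -, -, K, hDK⟩ := hf
  obtain ⟨M, hM⟩ := hbdd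
  have hq0 : 0 < q := by linarith
  have hp : (0 : ℝ) < n := hq0.trans hqn
  have hn : n ≠ 0 := by rintro rfl; simp at hp
  have hθ : 0 < q / n := by positivity
  have hθ1 : 0 < 1 - q / n := sub_pos.2 ((div_lt_one hp).2 hqn)
  -- Uniqueness of weak derivatives transfers the dilatation bound to the given `Df`.
  have hK : ∀ᵐ x, x ∈ Metric.ball (0 : QRMap.E n) 1 → ‖Df x‖ ^ n ≤ K * (Df x).det := by
    filter_upwards [hDf.ae_eq Metric.isOpen_ball hD,
      (ae_restrict_iff' measurableSet_ball).1 hDK] with x h1 h2 hx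
    rw [h1 hx]
    exact h2 hx
  set A := |K| * (|C| * (4 ^ ((n : ℝ) - 1) * 2 ^ b))
    * (volume (Metric.closedBall (0 : QRMap.E n) M)).toReal
  set B := n * (volume (Metric.ball (0 : QRMap.E n) 1)).toReal
  have hA : 0 ≤ A := by positivity
  have hB : 0 ≤ B := by positivity
  set L := A ^ (q / n) * B ^ (1 - q / n)
  have hring : ∀ j, ∫⁻ x in QRMap.dyadicRing n j,
      ENNReal.ofReal (‖Df x‖ ^ q * QRMap.weight n q c x)
        ≤ ENNReal.ofReal (L * (c j / ((j : ℝ) + 1) ^ (b * (q / n)))) := by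
    intro j
    have hmeas : AEStronglyMeasurable Df (volume.restrict (QRMap.dyadicRing n j)) := by
      refine hDf.locallyIntegrable_deriv.aestronglyMeasurable.mono_measure
        (Measure.restrict_mono (fun x hx => ?_) le_rfl)
      have h2 := hx.2
      have : (0 : ℝ) < 2⁻¹ ^ (j + 1) := by positivity
      rw [mem_ball_zero_iff]
      linarith
    set w := c j * ((2 : ℝ) ^ j) ^ (-(q - 1))
    have hw : 0 ≤ w := mul_nonneg (hc j).le (by positivity)
    calc ∫⁻ x in QRMap.dyadicRing n j, ENNReal.ofReal (‖Df x‖ ^ q * QRMap.weight n q c x)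
        ≤ ∫⁻ x in QRMap.dyadicRing n j, ENNReal.ofReal w * ‖Df x‖ₑ ^ q := by
          refine setLIntegral_mono' (QRMap.measurableSet_dyadicRing j) fun x hx => ?_
          rw [← ofReal_norm, ENNReal.ofReal_rpow_of_nonneg (norm_nonneg _) hq0.le,
            ← ENNReal.ofReal_mul hw, mul_comm]
          refine ENNReal.ofReal_le_ofReal ?_
          gcongr
          exact QRMap.weight_le_of_mem hq (hc j) hx
      _ = ENNReal.ofReal w * ∫⁻ x in QRMap.dyadicRing n j, ‖Df x‖ₑ ^ q :=
          lintegral_const_mul' _ _ ENNReal.ofReal_ne_top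
      _ ≤ ENNReal.ofReal w * ((∫⁻ x in QRMap.dyadicRing n j, ‖Df x‖ₑ ^ (n : ℝ)) ^ (q / n)
            * volume (QRMap.dyadicRing n j) ^ (1 - q / n)) := by
          gcongr
          exact QRMap.setLIntegral_enorm_rpow_le hmeas hq0 hqn
      _ ≤ ENNReal.ofReal w * (ENNReal.ofReal (A * ((2 : ℝ) ^ j) ^ ((n : ℝ) - 1)
            * ((j : ℝ) + 1) ^ (-b)) ^ (q / n)
            * ENNReal.ofReal (B * ((2 : ℝ) ^ j)⁻¹) ^ (1 - q / n)) := by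
          gcongr
          · exact hDf.lintegral_dyadicRing_le hb hK hM hN j
          · exact QRMap.volume_dyadicRing_le j
      _ = ENNReal.ofReal (L * (c j / ((j : ℝ) + 1) ^ (b * (q / n)))) := by
          rw [ENNReal.ofReal_rpow_of_nonneg (by positivity) hθ.le,
            ENNReal.ofReal_rpow_of_nonneg (by positivity) hθ1.le,
            ← ENNReal.ofReal_mul (by positivity), ← ENNReal.ofReal_mul hw]
          congr 1
          have := QRMap.rpow_cancel_exponents (b := b) (q := q) hA hB
            (show (0 : ℝ) < 2 ^ j by positivity) (show (0 : ℝ) < (j : ℝ) + 1 by positivity) hp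
          rw [div_eq_mul_inv (c j)]
          linear_combination c j * this
  have hsum' : Summable fun j : ℕ => L * (c j / ((j : ℝ) + 1) ^ (b * (q / n))) := by
    -- Dropping the term `j = 0` leaves `c (j + 1)` over a power of `j + 2`, dominated by the
    -- hypothesis with `j + 1`.
    refine Summable.mul_left L ((summable_nat_add_iff 1).1 ?_)
    refine hsum.of_nonneg_of_le (fun j => div_nonneg (hc _).le (by positivity)) fun j => ?_
    have := (hc (j + 1)).le
    gcongr
    linarith
  refine (QRMap.lintegral_ball_le_tsum_dyadicRing hn _).trans_lt
    ((ENNReal.tsum_le_tsum hring).trans_lt ?_)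
  rw [← ENNReal.ofReal_tsum_of_nonneg (fun j => ?_) hsum']
  · exact ENNReal.ofReal_lt_top
  · exact mul_nonneg (by positivity) (div_nonneg (hc j).le (by positivity))
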